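/- Let $(\Omega,\Sigma,P)$ be a probability space and let $(\Sigma_n)_{n\in\mathbb N}$ be an increasing sequence of finite sub-$\sigma$-algebras of $\Sigma$, where $\Sigma_n$ is generated by a finite partition $\mathcal D_n$ of $\Omega$ into nonempty sets. Assume that $P(D)>0$ for all $n$ and all $D\in\mathcal D_n$, and that for all $n$ and all $D\in\mathcal D_n$ there is $m>n$ with $D\notin\mathcal D_m$. Let $$K=\Big\{(D_n)\in\prod_{n}\mathcal D_n:\ D_m\subset D_n \text{ whenever } m\ge n\Big\},$$ with the topology inherited from the product of the discrete spaces $\mathcal D_n$. Let $M_{1,1}$ be the set of real martingales $\mathbf f=(f_n)$ adapted to $(\Sigma_n)$ with $\sup_n\|f_n\|_{L^1(P)}\le 1$, with the topology of pointwise convergence, i.e. the one inherited from the product of the normed spaces $L^1(\Omega,\Sigma_n,P|_{\Sigma_n})$. Every $f_n$ is constant on each $D\in\mathcal D_n$; for $x=(D_k)\in K$ let $f_n(x)$ denote the value of $f_n$ on $D_n$. Then there is a comeager subset $A$ of $M_{1,1}$ such that for each $\mathbf f=(f_n)\in A$: 1. $f_n\to 0$ $P$-almost surely; 2. the set $\{x\in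 K:\ \limsup_{n\to\infty} f_n(x)=+\infty \text{ and } \liminf_{n\to\infty} f_n(x)=-\infty\}$ is a dense $G_\delta$ subset of $K$. -/

import Mathlib

open MeasureTheory Filter Topology

/-- The inverse limit `K` of the finite partitions `𝒟 n`: sequences of cells `(D_n)` with `D_n ∈ 𝒟 n`
and `D_m ⊆ D_n` whenever `n ≤ m`. -/
def LimitSpace {Ω : Type*} (𝒟 : ℕ → Finpartition (Set.univ : Set Ω)) : Type _ :=
  {x : (n : ℕ) → {D : Set Ω // D ∈ (𝒟 n).parts} //
    ∀ n m : ℕ, n ≤ m → ((x m : Set Ω) ⊆ (x n : Set Ω))}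

/-- The topology of `K`: the subspace topology of the product of the discrete spaces `𝒟 n`. -/
instance LimitSpace.instTopologicalSpace {Ω : Type*}
    (𝒟 : ℕ → Finpartition (Set.univ : Set Ω)) : TopologicalSpace (LimitSpace 𝒟) :=
  TopologicalSpace.induced Subtype.val (@Pi.topologicalSpace ℕ _ (fun _ => ⊥))

/-- The `n`-th cell of a point of `K`. -/
def LimitSpace.cell {Ω : Type*} {𝒟 : ℕ → Finpartition (Set.univ : Set Ω)}
    (x : LimitSpace 𝒟) (n : ℕ) : Set Ω :=
  (x.1 n : Set Ω)

theorem LimitSpace.cell_nonempty {Ω : Type*} {𝒟 : ℕ → Finpartition (Set.univ : Set Ω)}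
    (x : LimitSpace 𝒟) (n : ℕ) : (x.cell n).Nonempty :=
  Set.nonempty_iff_ne_empty.2 ((𝒟 n).ne_bot (x.1 n).2)

/-- The value `f_n(x)` at `x = (D_k) ∈ K` of a sequence of functions `f_n : Ω → ℝ`, where `f_n` is
constant on each cell of `𝒟 n`: the value of `f_n` on the cell `D_n`, read off at a point of `D_n`. -/
noncomputable def valueAt {Ω : Type*} {𝒟 : ℕ → Finpartition (Set.univ : Set Ω)}
    (f : ℕ → Ω → ℝ) (n : ℕ) (x : LimitSpace 𝒟) : ℝ :=
  f n (x.cell_nonempty n).some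

/-- The space `M_{1,1}` of martingales `f = (f_n)` adapted to `ℱ` with
`‖f‖₁ = sup_n ‖f_n‖_{L¹} ≤ 1`. -/
def UnitMartingale {Ω : Type*} {m : MeasurableSpace Ω} (ℱ : Filtration ℕ m) (P : Measure Ω) :
    Type _ :=
  {f : ℕ → Ω → ℝ // Martingale f ℱ P ∧ ⨆ n, eLpNorm (f n) 1 P ≤ 1}

/-- The inclusion of `M_{1,1}` in the product of the `L¹` spaces. (The norm of `L¹(ℱ n)` is the
restriction of that of `L¹(m)`, so each factor may be taken to be the latter.) -/
noncomputable def UnitMartingale.toL1 {Ω : Type*} {m : MeasurableSpace Ω} {ℱ : Filtration ℕ m}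
    {P : Measure Ω} (f : UnitMartingale ℱ P) (n : ℕ) : Ω →₁[P] ℝ :=
  (f.2.1.integrable n).toL1 (f.1 n)

/-- The topology of pointwise convergence on `M_{1,1}`, inherited from the product topology of
the `L¹` spaces with their norm topologies. -/
noncomputable instance UnitMartingale.instTopologicalSpace {Ω : Type*} {m : MeasurableSpace Ω}
    (ℱ : Filtration ℕ m) (P : Measure Ω) : TopologicalSpace (UnitMartingale ℱ P) :=
  TopologicalSpace.induced UnitMartingale.toL1 (inferInstance : TopologicalSpace (ℕ → Ω →₁[P] ℝ))

/-- The set of `x ∈ K` with `limsup f_n(x) = +∞` and `liminf f_n(x) = -∞`. -/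
def oscillationSet {Ω : Type*} (𝒟 : ℕ → Finpartition (Set.univ : Set Ω)) (f : ℕ → Ω → ℝ) :
    Set (LimitSpace 𝒟) :=
  {x | limsup (fun n => ((valueAt f n x : ℝ) : EReal)) atTop = ⊤ ∧
    liminf (fun n => ((valueAt f n x : ℝ) : EReal)) atTop = ⊥}

/-!
The comeager set is an intersection of countably many open dense sets of two kinds.

* `exceedSet s N D`, for a sign `s`, a natural number `N` and a cell `D`: at some time `k ≥ N` the
  martingale satisfies `s * f_k > N` on some cell inside `D`. To reach this set from `f`, stop `f`
  at a late time, multiply it by `1 - e`, and use the freed amount `e` of `L¹` norm to add the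
  closed martingale of `s * e * 1_E / P(E)`, where `E ⊆ D` is a cell of tiny probability
  (`dense_exceedSet`).
* `smallSet j`: at some time `k ≥ j` the martingale is small in measure, in the sense that `∫ min
  |f_k| 1 < 1 / (j + 1)`. To reach this set from `f` without changing `f_0, …, f_n`, concentrate
  the mass of `f_n` on each cell `D` of `𝒟 n` on a tiny cell inside `D`
  (`exists_condExp_eq_integral_min_lt`, `dense_smallSet`).

Both constructions rest on `exists_subset_measureReal_lt`: since no cell survives forever, every
cell contains cells of later partitions of arbitrarily small probability. Both produce closed
martingales `n ↦ P[G | ℱ n]` with `G` measurable at a finite time, and for such martingales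
density follows from the approximation of single coordinates
(`UnitMartingale.dense_of_forall_exists_ofFun`).

A martingale in all the sets `smallSet j` has an almost sure limit by Doob's convergence theorem,
and bounded convergence applied to `min |f_n| 1` shows that the limit is `0`. For a martingale in
all the sets `exceedSet s N D`, the set of points of `K` at which `s * f_n > N` for some `n ≥ N`
is open and dense. The oscillation set is the intersection of these sets over `N` and `s = ±1`,
hence a dense `Gδ` by Baire's theorem in the compact Hausdorff space `K`.
-/

/-! ### Cells of the partitions -/

section Cells

variable {Ω : Type*} {m : MeasurableSpace Ω} {ℱ : Filtration ℕ m}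
  {𝒟 : ℕ → Finpartition (Set.univ : Set Ω)}

theorem Finpartition.exists_set_mem_parts (Q : Finpartition (Set.univ : Set Ω)) (ω : Ω) :
    ∃ D ∈ Q.parts, ω ∈ D := by
  have h : ω ∈ Q.parts.sup id := by rw [Q.sup_parts]; trivial
  simpa [Finset.sup_set_eq_biUnion] using h

theorem Finpartition.eq_of_mem_of_mem {Q : Finpartition (Set.univ : Set Ω)} {D E : Set Ω}
    (hD : D ∈ Q.parts) (hE : E ∈ Q.parts) {ω : Ω} (hωD : ω ∈ D) (hωE : ω ∈ E) : D = E := by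
  by_contra hne
  exact Set.disjoint_left.1 (Q.disjoint hD hE hne) hωD hωE

/-- The cells of a partition are atoms of the `σ`-algebra it generates. -/
theorem Finpartition.subset_or_disjoint_of_measurableSet {Q : Finpartition (Set.univ : Set Ω)}
    {D S : Set Ω} (hD : D ∈ Q.parts)
    (hS : MeasurableSet[MeasurableSpace.generateFrom {D : Set Ω | D ∈ Q.parts}] S) :
    D ⊆ S ∨ Disjoint D S := by
  induction S, hS using MeasurableSpace.generateFrom_induction with
  | hC t ht _ =>
    by_cases h : D = t
    · exact Or.inl h.le
    · exact Or.inr (Q.disjoint hD ht h)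
  | empty => exact Or.inr (Set.disjoint_empty D)
  | compl t _ ih =>
    rcases ih with h | h
    · exact Or.inr (Set.disjoint_compl_right_iff_subset.2 h)
    · exact Or.inl (Set.subset_compl_iff_disjoint_right.2 h)
  | iUnion s _ ih =>
    by_cases h : ∃ i, D ⊆ s i
    · obtain ⟨i, hi⟩ := h
      exact Or.inl (hi.trans (Set.subset_iUnion s i))
    · push Not at h
      exact Or.inr (Set.disjoint_iUnion_right.2 fun i => (ih i).resolve_left (h i))

theorem measurableSet_of_mem_parts
    (h_gen : ∀ n, ℱ n = MeasurableSpace.generateFrom {D : Set Ω | D ∈ (𝒟 n).parts})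
    {n : ℕ} {D : Set Ω} (hD : D ∈ (𝒟 n).parts) : MeasurableSet[ℱ n] D := by
  rw [h_gen n]
  exact MeasurableSpace.measurableSet_generateFrom hD

theorem subset_or_disjoint_of_mem_parts
    (h_gen : ∀ n, ℱ n = MeasurableSpace.generateFrom {D : Set Ω | D ∈ (𝒟 n).parts})
    {n : ℕ} {D S : Set Ω} (hD : D ∈ (𝒟 n).parts) (hS : MeasurableSet[ℱ n] S) :
    D ⊆ S ∨ Disjoint D S := by
  rw [h_gen n] at hS
  exact Finpartition.subset_or_disjoint_of_measurableSet hD hS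

/-- The partitions refine each other: a later cell lies in every earlier cell that it meets. -/
theorem subset_of_mem_parts_of_le
    (h_gen : ∀ n, ℱ n = MeasurableSpace.generateFrom {D : Set Ω | D ∈ (𝒟 n).parts})
    {n k : ℕ} (hnk : n ≤ k) {D E : Set Ω} (hD : D ∈ (𝒟 n).parts) (hE : E ∈ (𝒟 k).parts)
    {ω : Ω} (hωD : ω ∈ D) (hωE : ω ∈ E) : E ⊆ D :=
  (subset_or_disjoint_of_mem_parts h_gen hE
    (ℱ.mono hnk D (measurableSet_of_mem_parts h_gen hD))).resolve_right
    fun h => Set.disjoint_left.1 h hωE hωD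

theorem eq_of_mem_of_mem_of_stronglyMeasurable
    (h_gen : ∀ n, ℱ n = MeasurableSpace.generateFrom {D : Set Ω | D ∈ (𝒟 n).parts})
    {n : ℕ} {D : Set Ω} (hD : D ∈ (𝒟 n).parts) {f : Ω → ℝ} (hf : StronglyMeasurable[ℱ n] f)
    {ω ω' : Ω} (hω : ω ∈ D) (hω' : ω' ∈ D) : f ω = f ω' := by
  have hS : MeasurableSet[ℱ n] (f ⁻¹' {f ω'}) := hf.measurable (measurableSet_singleton _)
  exact (subset_or_disjoint_of_mem_parts h_gen hD hS).resolve_right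
    (fun h => Set.disjoint_left.1 h hω' rfl) hω

/-- Since every cell is eventually split, each cell contains cells of later partitions of
probability at most `2⁻ʲ`: after a split, one of two distinct subcells has at most half of the
probability. -/
theorem exists_subset_measureReal_le_pow (P : Measure Ω) [IsProbabilityMeasure P]
    (h_gen : ∀ n, ℱ n = MeasurableSpace.generateFrom {D : Set Ω | D ∈ (𝒟 n).parts})
    (h_split : ∀ n, ∀ D ∈ (𝒟 n).parts, ∃ k, n < k ∧ D ∉ (𝒟 k).parts)
    {n : ℕ} {D : Set Ω} (hD : D ∈ (𝒟 n).parts) (j : ℕ) :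
    ∃ k, n + j ≤ k ∧ ∃ E ∈ (𝒟 k).parts, E ⊆ D ∧ P.real E ≤ (1 / 2) ^ j := by
  induction j with
  | zero => exact ⟨n, le_rfl, D, hD, subset_rfl, by simp⟩
  | succ j ih =>
    obtain ⟨k, hk, E, hE, hED, hPE⟩ := ih
    obtain ⟨l, hkl, hEl⟩ := h_split k E hE
    obtain ⟨ω, hω⟩ : E.Nonempty := Set.nonempty_iff_ne_empty.2 ((𝒟 k).ne_bot hE)
    obtain ⟨A, hA, hωA⟩ := (𝒟 l).exists_set_mem_parts ω
    have hAE : A ⊆ E := subset_of_mem_parts_of_le h_gen hkl.le hE hA hω hωA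
    have hne : ¬ E ⊆ A := fun h => hEl (h.antisymm hAE ▸ hA)
    obtain ⟨ω', hω', hω'A⟩ := Set.not_subset.1 hne
    obtain ⟨B, hB, hωB⟩ := (𝒟 l).exists_set_mem_parts ω'
    have hBE : B ⊆ E := subset_of_mem_parts_of_le h_gen hkl.le hE hB hω' hωB
    have hdisj : Disjoint A B := (𝒟 l).disjoint hA hB fun h => hω'A (h ▸ hωB)
    have hsum : P.real A + P.real B ≤ P.real E := by
      rw [← measureReal_union hdisj (ℱ.le l B (measurableSet_of_mem_parts h_gen hB))]
      exact measureReal_mono (Set.union_subset hAE hBE)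
    rcases le_total (P.real A) (P.real B) with h | h
    · exact ⟨l, by omega, A, hA, hAE.trans hED, by rw [pow_succ]; linarith⟩
    · exact ⟨l, by omega, B, hB, hBE.trans hED, by rw [pow_succ]; linarith⟩

theorem exists_subset_measureReal_lt (P : Measure Ω) [IsProbabilityMeasure P]
    (h_gen : ∀ n, ℱ n = MeasurableSpace.generateFrom {D : Set Ω | D ∈ (𝒟 n).parts})
    (h_split : ∀ n, ∀ D ∈ (𝒟 n).parts, ∃ k, n < k ∧ D ∉ (𝒟 k).parts)
    {n : ℕ} {D : Set Ω} (hD : D ∈ (𝒟 n).parts) (N : ℕ) {δ : ℝ} (hδ : 0 < δ) :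
    ∃ k, N ≤ k ∧ n ≤ k ∧ ∃ E ∈ (𝒟 k).parts, E ⊆ D ∧ P.real E < δ := by
  obtain ⟨j, hj⟩ := exists_pow_lt_of_lt_one hδ (by norm_num : (1 / 2 : ℝ) < 1)
  obtain ⟨k, hk, E, hE, hED, hPE⟩ :=
    exists_subset_measureReal_le_pow P h_gen h_split hD (max j N)
  refine ⟨k, by omega, by omega, E, hE, hED, hPE.trans_lt (lt_of_le_of_lt ?_ hj)⟩
  exact pow_le_pow_of_le_one (by norm_num) (by norm_num) (le_max_left _ _)

end Cells

/-! ### The limit space -/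

section LimitSpace

variable {Ω : Type*} {m : MeasurableSpace Ω} {ℱ : Filtration ℕ m}
  {𝒟 : ℕ → Finpartition (Set.univ : Set Ω)}

namespace LimitSpace

/-- The `n`-th cell depends on the point of the limit space in a locally constant way. -/
theorem isOpen_setOf_cell (n : ℕ) (p : Set Ω → Prop) :
    IsOpen {x : LimitSpace 𝒟 | p (x.cell n)} := by
  let _ : ∀ n, TopologicalSpace {D : Set Ω // D ∈ (𝒟 n).parts} := fun _ => ⊥
  have : ∀ n, DiscreteTopology {D : Set Ω // D ∈ (𝒟 n).parts} := fun _ => ⟨rfl⟩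
  have hc : Continuous fun x : LimitSpace 𝒟 => x.1 n :=
    (continuous_apply n).comp continuous_induced_dom
  exact (isOpen_discrete {D : {D : Set Ω // D ∈ (𝒟 n).parts} | p D}).preimage hc

theorem baireSpace (𝒟 : ℕ → Finpartition (Set.univ : Set Ω)) : BaireSpace (LimitSpace 𝒟) := by
  let _ : ∀ n, TopologicalSpace {D : Set Ω // D ∈ (𝒟 n).parts} := fun _ => ⊥
  have : ∀ n, DiscreteTopology {D : Set Ω // D ∈ (𝒟 n).parts} := fun _ => ⟨rfl⟩
  have hclosed : IsClosed {x : (n : ℕ) → {D : Set Ω // D ∈ (𝒟 n).parts} |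
      ∀ n k : ℕ, n ≤ k → ((x k : Set Ω) ⊆ (x n : Set Ω))} := by
    simp only [Set.ofPred_forall]
    refine isClosed_iInter fun n => isClosed_iInter fun k => isClosed_iInter fun _ => ?_
    have hc : Continuous fun x : (n : ℕ) → {D : Set Ω // D ∈ (𝒟 n).parts} => (x k, x n) :=
      (continuous_apply k).prodMk (continuous_apply n)
    exact (isClosed_discrete {q : {D : Set Ω // D ∈ (𝒟 k).parts} × {D : Set Ω // D ∈ (𝒟 n).parts} |
      (q.1 : Set Ω) ⊆ q.2}).preimage hc
  have hemb : IsClosedEmbedding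
      (Subtype.val : LimitSpace 𝒟 → (n : ℕ) → {D : Set Ω // D ∈ (𝒟 n).parts}) :=
    hclosed.isClosedEmbedding_subtypeVal
  have : CompactSpace (LimitSpace 𝒟) := hemb.compactSpace
  have : T2Space (LimitSpace 𝒟) := hemb.isEmbedding.t2Space
  infer_instance

/-- Every neighbourhood in the limit space contains the set of all points with a given cell. -/
theorem exists_cell_subset {U : Set (LimitSpace 𝒟)} (hU : IsOpen U) {x : LimitSpace 𝒟}
    (hx : x ∈ U) : ∃ n, ∀ y : LimitSpace 𝒟, y.cell n ⊆ x.cell n → y ∈ U := by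
  let _ : ∀ n, TopologicalSpace {D : Set Ω // D ∈ (𝒟 n).parts} := fun _ => ⊥
  obtain ⟨V, hV, rfl⟩ := isOpen_induced_iff.1 hU
  obtain ⟨I, u, hu, hIV⟩ := isOpen_pi_iff.1 hV x.1 hx
  refine ⟨I.sup id, fun y hy => hIV fun i hi => ?_⟩
  have hle : i ≤ I.sup id := Finset.le_sup (f := id) hi
  obtain ⟨ω, hω⟩ := y.cell_nonempty (I.sup id)
  have : y.1 i = x.1 i := Subtype.ext <|
    Finpartition.eq_of_mem_of_mem (y.1 i).2 (x.1 i).2 (y.2 _ _ hle hω) (x.2 _ _ hle (hy hω))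
  rw [this]
  exact (hu i hi).2

/-- Every cell is a coordinate of a point of the limit space: take all cells through one of its
elements. -/
theorem exists_cell_eq
    (h_gen : ∀ n, ℱ n = MeasurableSpace.generateFrom {D : Set Ω | D ∈ (𝒟 n).parts})
    {n : ℕ} {D : Set Ω} (hD : D ∈ (𝒟 n).parts) : ∃ x : LimitSpace 𝒟, x.cell n = D := by
  obtain ⟨ω, hω⟩ : D.Nonempty := Set.nonempty_iff_ne_empty.2 ((𝒟 n).ne_bot hD)
  choose C hC hωC using fun k => (𝒟 k).exists_set_mem_parts ω
  refine ⟨⟨fun k => ⟨C k, hC k⟩, fun k l hkl =>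
    subset_of_mem_parts_of_le h_gen hkl (hC k) (hC l) (hωC k) (hωC l)⟩, ?_⟩
  exact Finpartition.eq_of_mem_of_mem (hC n) hD (hωC n) hω

end LimitSpace

theorem isOpen_setOf_valueAt (f : ℕ → Ω → ℝ) (n : ℕ) (p : ℝ → Prop) :
    IsOpen {x : LimitSpace 𝒟 | p (valueAt f n x)} := by
  classical
  have h := LimitSpace.isOpen_setOf_cell (𝒟 := 𝒟) n
    fun D => if h : D.Nonempty then p (f n h.some) else False
  convert h using 3 with x
  rw [dif_pos (x.cell_nonempty n)]
  rfl

theorem limsup_coe_eq_top_iff {u : ℕ → ℝ} :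
    limsup (fun n => (u n : EReal)) atTop = ⊤ ↔ ∀ N : ℕ, ∃ n, N ≤ n ∧ (N : ℝ) < u n := by
  constructor
  · intro h N
    have : ((N : ℝ) : EReal) < limsup (fun n => (u n : EReal)) atTop := h ▸ EReal.coe_lt_top _
    obtain ⟨n, hn, hlt⟩ :=
      frequently_atTop.1 (frequently_lt_of_lt_limsup (by isBoundedDefault) this) N
    exact ⟨n, hn, EReal.coe_lt_coe_iff.1 hlt⟩
  · intro h
    rw [EReal.eq_top_iff_forall_lt]
    intro y
    obtain ⟨N₀, hN₀⟩ := exists_nat_gt y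
    refine (EReal.coe_lt_coe_iff.2 hN₀).trans_le
      (le_limsup_of_frequently_le (frequently_atTop.2 fun M => ?_) (by isBoundedDefault))
    obtain ⟨n, hn, hlt⟩ := h (max M N₀)
    refine ⟨n, (le_max_left _ _).trans hn, EReal.coe_le_coe_iff.2 (le_trans ?_ hlt.le)⟩
    exact_mod_cast le_max_right M N₀

theorem liminf_coe_eq_bot_iff {u : ℕ → ℝ} :
    liminf (fun n => (u n : EReal)) atTop = ⊥ ↔ ∀ N : ℕ, ∃ n, N ≤ n ∧ (N : ℝ) < -u n := by
  rw [← limsup_coe_eq_top_iff (u := fun n => -u n), ← EReal.neg_eq_top_iff, ← EReal.limsup_neg]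
  simp [Pi.neg_def]

theorem oscillationSet_eq_iInter (f : ℕ → Ω → ℝ) :
    oscillationSet 𝒟 f =
      (⋂ N : ℕ, {x | ∃ n, N ≤ n ∧ (N : ℝ) < valueAt f n x}) ∩
        ⋂ N : ℕ, {x | ∃ n, N ≤ n ∧ (N : ℝ) < -valueAt f n x} := by
  ext x
  simp only [oscillationSet, Set.mem_ofPred_eq, limsup_coe_eq_top_iff, liminf_coe_eq_bot_iff,
    Set.mem_inter_iff, Set.mem_iInter]

end LimitSpace

/-! ### The space of martingales -/

section UnitMartingale

open scoped ENNReal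

variable {Ω : Type*} {m : MeasurableSpace Ω} {P : Measure Ω}
  {ℱ : Filtration ℕ m}

namespace UnitMartingale

/-- The closed martingale `n ↦ P[G | ℱ n]` as a point of `M_{1,1}`. -/
noncomputable def ofFun [IsProbabilityMeasure P] (ℱ : Filtration ℕ m) (G : Ω → ℝ)
    (hG : eLpNorm G 1 P ≤ 1) :
    UnitMartingale ℱ P :=
  ⟨fun n => P[G | ℱ n], martingale_condExp G ℱ P,
    iSup_le fun _ => (eLpNorm_condExp_le_eLpNorm G le_rfl).trans hG⟩

theorem continuous_toL1 (n : ℕ) : Continuous fun f : UnitMartingale ℱ P => f.toL1 n :=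
  have h : Continuous (toL1 : UnitMartingale ℱ P → ℕ → Ω →₁[P] ℝ) := continuous_induced_dom
  (continuous_apply n).comp h

theorem edist_toL1 (f g : UnitMartingale ℱ P) (n : ℕ) :
    edist (f.toL1 n) (g.toL1 n) = eLpNorm (f.1 n - g.1 n) 1 P :=
  Lp.edist_toLp_toLp _ _ (memLp_one_iff_integrable.2 (f.2.1.integrable n))
    (memLp_one_iff_integrable.2 (g.2.1.integrable n))

theorem eLpNorm_le_one (f : UnitMartingale ℱ P) (n : ℕ) : eLpNorm (f.1 n) 1 P ≤ 1 :=
  (le_iSup (fun n => eLpNorm (f.1 n) 1 P) n).trans f.2.2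

theorem eLpNorm_condExp_sub_le (f : UnitMartingale ℱ P) {G : Ω → ℝ} (hG : Integrable G P)
    {k n : ℕ} (hkn : k ≤ n) : eLpNorm (P[G | ℱ k] - f.1 k) 1 P ≤ eLpNorm (G - f.1 n) 1 P := by
  have h : P[G - f.1 n | ℱ k] =ᵐ[P] P[G | ℱ k] - f.1 k :=
    (condExp_sub hG (f.2.1.integrable n) (ℱ k)).trans
      (EventuallyEq.rfl.sub (f.2.1.2 k n hkn))
  rw [← eLpNorm_congr_ae h]
  exact eLpNorm_condExp_le_eLpNorm _ le_rfl

/-- Convergence in `M_{1,1}` only concerns finitely many coordinates at a time, and the earlier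
coordinates of a martingale are contractive images of the later ones. Hence a set is dense as soon
as the closed martingales in it approximate every single coordinate of every martingale. -/
theorem dense_of_forall_exists_ofFun [IsProbabilityMeasure P] {V : Set (UnitMartingale ℱ P)}
    (h : ∀ (f : UnitMartingale ℱ P) (n : ℕ) (ε : ℝ), 0 < ε → ∃ (G : Ω → ℝ) (hG : eLpNorm G 1 P ≤ 1),
      Integrable G P ∧ eLpNorm (P[G | ℱ n] - f.1 n) 1 P ≤ ENNReal.ofReal ε ∧ ofFun ℱ G hG ∈ V) :
    Dense V := by
  intro f
  choose G hG hint happrox hV using fun j : ℕ => h f j (1 / ((j : ℝ) + 1)) (by positivity)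
  refine mem_closure_of_tendsto (f := fun j => ofFun ℱ (G j) (hG j)) (b := atTop) ?_
    (Eventually.of_forall hV)
  have hind : IsInducing (toL1 : UnitMartingale ℱ P → ℕ → Ω →₁[P] ℝ) := ⟨rfl⟩
  rw [hind.tendsto_nhds_iff, tendsto_pi_nhds]
  intro k
  rw [tendsto_iff_edist_tendsto_0]
  have h0 : Tendsto (fun j : ℕ => ENNReal.ofReal (1 / ((j : ℝ) + 1))) atTop (𝓝 0) := by
    rw [← ENNReal.ofReal_zero]
    exact ENNReal.tendsto_ofReal tendsto_one_div_add_atTop_nhds_zero_nat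
  refine tendsto_of_tendsto_of_tendsto_of_le_of_le' tendsto_const_nhds h0
    (Eventually.of_forall fun _ => bot_le) ?_
  filter_upwards [eventually_ge_atTop k] with j hkj
  calc edist ((ofFun ℱ (G j) (hG j)).toL1 k) (f.toL1 k)
      = eLpNorm (P[G j | ℱ k] - f.1 k) 1 P := edist_toL1 _ _ _
    _ = eLpNorm (P[P[G j | ℱ j] | ℱ k] - f.1 k) 1 P :=
      eLpNorm_congr_ae ((condExp_condExp_of_le (ℱ.mono hkj) (ℱ.le j)).symm.sub EventuallyEq.rfl)
    _ ≤ eLpNorm (P[G j | ℱ j] - f.1 j) 1 P := f.eLpNorm_condExp_sub_le integrable_condExp hkj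
    _ ≤ _ := happrox j

/-- The integral over `S` of the `n`-th member of a martingale depends continuously on it. -/
theorem continuous_setIntegral (n : ℕ) (S : Set Ω) :
    Continuous fun f : UnitMartingale ℱ P => ∫ ω in S, f.1 n ω ∂P := by
  have h := (MeasureTheory.continuous_setIntegral (μ := P) (E := ℝ) S).comp
    (continuous_toL1 (ℱ := ℱ) (P := P) n)
  refine h.congr fun f => ?_
  exact integral_congr_ae (ae_restrict_of_ae (Integrable.coeFn_toL1 (f.2.1.integrable n)))

theorem integrable_min_abs_one [IsProbabilityMeasure P] {g : Ω → ℝ} (hg : Integrable g P) :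
    Integrable (fun ω => min |g ω| 1) P := hg.abs.inf (integrable_const 1)

theorem continuous_integral_min_abs_one [IsProbabilityMeasure P] (n : ℕ) :
    Continuous fun f : UnitMartingale ℱ P => ∫ ω, min |f.1 n ω| 1 ∂P := by
  have hlip : LipschitzWith 1 fun g : Ω →₁[P] ℝ => ∫ ω, min |g ω| 1 ∂P := by
    refine LipschitzWith.of_dist_le_mul fun g h => ?_
    have hg := L1.integrable_coeFn g
    have hh := L1.integrable_coeFn h
    rw [NNReal.coe_one, one_mul, dist_eq_norm, L1.dist_eq_integral_dist,
      ← integral_sub (integrable_min_abs_one hg) (integrable_min_abs_one hh)]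
    refine (norm_integral_le_integral_norm _).trans (integral_mono
      ((integrable_min_abs_one hg).sub (integrable_min_abs_one hh)).norm ?_
      fun ω => ?_)
    · exact (hg.sub hh).norm
    exact (abs_min_sub_min_le_max _ _ _ _).trans
      (max_le (abs_abs_sub_abs_le _ _) (by simp))
  refine (hlip.continuous.comp (continuous_toL1 (ℱ := ℱ) (P := P) n)).congr fun f => ?_
  refine integral_congr_ae ?_
  filter_upwards [Integrable.coeFn_toL1 (f.2.1.integrable n)] with ω hω
  simp only [toL1]
  rw [hω]

end UnitMartingale

end UnitMartingale

/-! ### Generic properties of martingales -/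

section Generic

open scoped ENNReal

variable {Ω : Type*} {m : MeasurableSpace Ω} {P : Measure Ω}
  {ℱ : Filtration ℕ m} {𝒟 : ℕ → Finpartition (Set.univ : Set Ω)}

/-- The martingales whose value, multiplied by the sign `s`, exceeds `N` at some time after `N` on
some cell contained in `D`. Values on cells are written as averages. -/
def exceedSet (ℱ : Filtration ℕ m) (P : Measure Ω) (𝒟 : ℕ → Finpartition (Set.univ : Set Ω))
    (s : ℝ) (N : ℕ) (D : Set Ω) : Set (UnitMartingale ℱ P) :=
  {f | ∃ k, N ≤ k ∧ ∃ E ∈ (𝒟 k).parts, E ⊆ D ∧ N * P.real E < s * ∫ ω in E, f.1 k ω ∂P}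

theorem isOpen_exceedSet (s : ℝ) (N : ℕ) (D : Set Ω) : IsOpen (exceedSet ℱ P 𝒟 s N D) := by
  have h : exceedSet ℱ P 𝒟 s N D = ⋃ k, ⋃ (_ : N ≤ k), ⋃ E ∈ (𝒟 k).parts, ⋃ (_ : E ⊆ D),
      {f | N * P.real E < s * ∫ ω in E, f.1 k ω ∂P} := by
    ext f
    simp only [exceedSet, Set.mem_ofPred_eq, Set.mem_iUnion, exists_prop]
  rw [h]
  refine isOpen_iUnion fun k => isOpen_iUnion fun _ => isOpen_iUnion fun E => isOpen_iUnion fun _ =>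
    isOpen_iUnion fun _ => ?_
  exact isOpen_lt continuous_const
    (continuous_const.mul (UnitMartingale.continuous_setIntegral k E))

variable [IsProbabilityMeasure P]

theorem eLpNorm_one_indicator_const_div {E : Set Ω} (hE : MeasurableSet E) (hPE : P E ≠ 0) (c : ℝ) :
    eLpNorm (E.indicator fun _ => c / P.real E) 1 P = ENNReal.ofReal |c| := by
  have hp : 0 < P.real E := ENNReal.toReal_pos hPE (measure_ne_top P E)
  rw [eLpNorm_indicator_const hE one_ne_zero ENNReal.one_ne_top, ← ofReal_norm,
    ← ofReal_measureReal, ENNReal.toReal_one, div_one, ENNReal.rpow_one,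
    ← ENNReal.ofReal_mul (norm_nonneg _), Real.norm_eq_abs, abs_div, abs_of_pos hp,
    div_mul_cancel₀ _ hp.ne']

/-- Shrink a martingale, stopped at time `n`, by the factor `1 - e`, and put mass `e` with the sign
`s` on a cell inside `D` so small that its density there is as large as desired. -/
theorem dense_exceedSet
    (h_gen : ∀ n, ℱ n = MeasurableSpace.generateFrom {D : Set Ω | D ∈ (𝒟 n).parts})
    (h_pos : ∀ n, ∀ D ∈ (𝒟 n).parts, 0 < P D)
    (h_split : ∀ n, ∀ D ∈ (𝒟 n).parts, ∃ k, n < k ∧ D ∉ (𝒟 k).parts)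
    {s : ℝ} (hs : |s| = 1) (N : ℕ) {l : ℕ} {D : Set Ω} (hD : D ∈ (𝒟 l).parts) :
    Dense (exceedSet ℱ P 𝒟 s N D) := by
  refine UnitMartingale.dense_of_forall_exists_ofFun fun f n ε hε => ?_
  set e : ℝ := min (ε / 2) 1 with he
  have he0 : 0 < e := lt_min (by positivity) one_pos
  have he1 : e ≤ 1 := min_le_right _ _
  obtain ⟨ω, hω⟩ : D.Nonempty := Set.nonempty_iff_ne_empty.2 ((𝒟 l).ne_bot hD)
  obtain ⟨C, hC, hωC⟩ := (𝒟 (max n l)).exists_set_mem_parts ω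
  have hCD : C ⊆ D := subset_of_mem_parts_of_le h_gen (le_max_right n l) hD hC hω hωC
  set a := f.1 n ω with ha
  have hfn : StronglyMeasurable[ℱ (max n l)] (f.1 n) := (f.2.1.1 n).mono (ℱ.mono (le_max_left n l))
  obtain ⟨k, hNk, hk, E, hE, hEC, hPE⟩ := exists_subset_measureReal_lt P h_gen h_split hC N
    (show 0 < e / (N + |a| + 1) by positivity)
  have hEm : MeasurableSet[ℱ k] E := measurableSet_of_mem_parts h_gen hE
  have hp : 0 < P.real E := ENNReal.toReal_pos (h_pos k E hE).ne' (measure_ne_top P E)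
  set h : Ω → ℝ := E.indicator fun _ => s * e / P.real E with hh
  have hhn : eLpNorm h 1 P = ENNReal.ofReal e := by
    rw [hh, eLpNorm_one_indicator_const_div (ℱ.le k E hEm) (h_pos k E hE).ne', abs_mul, hs, one_mul,
      abs_of_pos he0]
  have hhm : StronglyMeasurable[ℱ k] h := stronglyMeasurable_const.indicator hEm
  have hhi : Integrable h P := (integrable_const _).indicator (ℱ.le k E hEm)
  have hfi := f.2.1.integrable n
  have hsmul : ∀ c : ℝ, eLpNorm (c • f.1 n) 1 P ≤ ENNReal.ofReal |c| := fun c => by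
    rw [eLpNorm_const_smul, ← ofReal_norm, Real.norm_eq_abs]
    exact mul_le_of_le_one_right' (f.eLpNorm_le_one n)
  set G : Ω → ℝ := (1 - e) • f.1 n + h with hG
  have hGi : Integrable G P := (hfi.smul (1 - e)).add hhi
  have hG1 : eLpNorm G 1 P ≤ 1 := by
    calc eLpNorm G 1 P ≤ eLpNorm ((1 - e) • f.1 n) 1 P + eLpNorm h 1 P :=
          eLpNorm_add_le (hfi.smul (1 - e)).aestronglyMeasurable hhi.aestronglyMeasurable le_rfl
      _ ≤ ENNReal.ofReal |1 - e| + ENNReal.ofReal e := add_le_add (hsmul _) hhn.le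
      _ = 1 := by
        rw [abs_of_nonneg (by linarith), ← ENNReal.ofReal_add (by linarith) he0.le]
        simp
  have hGm : StronglyMeasurable[ℱ k] G :=
    ((hfn.mono (ℱ.mono hk)).const_smul (1 - e)).add hhm
  refine ⟨G, hG1, hGi, ?_, k, hNk, E, hE, hEC.trans hCD, ?_⟩
  · have hsub : G - f.1 n = (-e) • f.1 n + h := by
      rw [hG]; module
    calc eLpNorm (P[G | ℱ n] - f.1 n) 1 P ≤ eLpNorm (G - f.1 n) 1 P :=
          f.eLpNorm_condExp_sub_le hGi le_rfl
      _ ≤ eLpNorm ((-e) • f.1 n) 1 P + eLpNorm h 1 P := by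
          rw [hsub]
          exact eLpNorm_add_le (hfi.smul (-e)).aestronglyMeasurable hhi.aestronglyMeasurable le_rfl
      _ ≤ ENNReal.ofReal |-e| + ENNReal.ofReal e := add_le_add (hsmul _) hhn.le
      _ ≤ ENNReal.ofReal ε := by
        rw [abs_neg, abs_of_pos he0, ← ENNReal.ofReal_add he0.le he0.le]
        exact ENNReal.ofReal_le_ofReal (by linarith [min_le_left (ε / 2) 1])
  · have hcond : (UnitMartingale.ofFun ℱ G hG1).1 k = G :=
      condExp_of_stronglyMeasurable (ℱ.le k) hGm hGi
    have hval : ∀ ω' ∈ E, G ω' = (1 - e) * a + s * e / P.real E := fun ω' hω' => by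
      have : f.1 n ω' = a :=
        eq_of_mem_of_mem_of_stronglyMeasurable h_gen hC hfn (hEC hω') hωC
      simp [hG, hh, this, hω']
    rw [hcond, setIntegral_congr_fun (ℱ.le k E hEm) hval, setIntegral_const, smul_eq_mul]
    have hss : s * s = 1 := by rw [← abs_mul_abs_self, hs, one_mul]
    have heq : s * (P.real E * ((1 - e) * a + s * e / P.real E)) =
        (1 - e) * (s * a) * P.real E + e := by
      field_simp
      linear_combination e * hss
    have hsa : -|a| ≤ (1 - e) * (s * a) := by
      have h1 : |(1 - e) * (s * a)| ≤ |a| := by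
        rw [abs_mul, abs_mul, hs, one_mul, abs_of_nonneg (by linarith : 0 ≤ 1 - e)]
        exact mul_le_of_le_one_left (abs_nonneg a) (by linarith)
      exact (abs_le.1 h1).1
    rw [heq]
    rw [lt_div_iff₀ (by positivity)] at hPE
    nlinarith [mul_le_mul_of_nonneg_right hsa hp.le]

/-- Every member `f_n` of a martingale can be redistributed within the cells of `𝒟 n`, keeping the
mass of each of them and not increasing the norm, so as to live on a set of small probability. -/
theorem exists_condExp_eq_integral_min_lt
    (h_gen : ∀ n, ℱ n = MeasurableSpace.generateFrom {D : Set Ω | D ∈ (𝒟 n).parts})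
    (h_pos : ∀ n, ∀ D ∈ (𝒟 n).parts, 0 < P D)
    (h_split : ∀ n, ∀ D ∈ (𝒟 n).parts, ∃ k, n < k ∧ D ∉ (𝒟 k).parts)
    {n : ℕ} {f : Ω → ℝ} (hfm : StronglyMeasurable[ℱ n] f) (hf : Integrable f P)
    (N : ℕ) {δ : ℝ} (hδ : 0 < δ) :
    ∃ k, N ≤ k ∧ ∃ G : Ω → ℝ, StronglyMeasurable[ℱ k] G ∧ Integrable G P ∧
      eLpNorm G 1 P ≤ eLpNorm f 1 P ∧ P[G | ℱ n] =ᵐ[P] f ∧ ∫ ω, min |G ω| 1 ∂P < δ := by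
  classical
  set r : ℝ := ((𝒟 n).parts.card : ℝ) with hr
  have hδ' : 0 < δ / (r + 1) := by positivity
  choose k hNk hnk E hE hED hPE using fun D : (𝒟 n).parts =>
    exists_subset_measureReal_lt P h_gen h_split D.2 N hδ'
  have hEm : ∀ D, MeasurableSet (E D) := fun D =>
    ℱ.le _ _ (measurableSet_of_mem_parts h_gen (hE D))
  have hDm : ∀ D : (𝒟 n).parts, MeasurableSet (D : Set Ω) := fun D =>
    ℱ.le _ _ (measurableSet_of_mem_parts h_gen D.2)
  have hdisj : Pairwise (Function.onFun Disjoint fun D : (𝒟 n).parts => (D : Set Ω)) :=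
    fun D D' hne => (𝒟 n).disjoint D.2 D'.2 fun h => hne (Subtype.ext h)
  have hU : ⋃ D : (𝒟 n).parts, (D : Set Ω) = Set.univ := Set.eq_univ_of_forall fun ω => by
    obtain ⟨D, hD, hω⟩ := (𝒟 n).exists_set_mem_parts ω
    exact Set.mem_iUnion.2 ⟨⟨D, hD⟩, hω⟩
  set c : (𝒟 n).parts → ℝ := fun D => ∫ ω in (D : Set Ω), f ω ∂P with hc
  set g : (𝒟 n).parts → Ω → ℝ := fun D => (E D).indicator fun _ => c D / P.real (E D) with hg
  have hgi : ∀ D, Integrable (g D) P := fun D => (integrable_const _).indicator (hEm D)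
  set K : ℕ := N + ∑ D, k D with hK
  have hkK : ∀ D, k D ≤ K := fun D =>
    (Finset.single_le_sum (f := k) (fun _ _ => Nat.zero_le _) (Finset.mem_univ D)).trans
      (Nat.le_add_left _ _)
  have hGi : Integrable (∑ D, g D) P := integrable_finsetSum' _ fun D _ => hgi D
  refine ⟨K, Nat.le_add_right _ _, ∑ D, g D, ?_, hGi, ?_, ?_, ?_⟩
  · refine Finset.stronglyMeasurable_sum _ fun D _ => stronglyMeasurable_const.indicator ?_
    exact ℱ.mono (hkK D) _ (measurableSet_of_mem_parts h_gen (hE D))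
  · calc eLpNorm (∑ D, g D) 1 P ≤ ∑ D, eLpNorm (g D) 1 P :=
          eLpNorm_sum_le (fun D _ => (hgi D).aestronglyMeasurable) le_rfl
      _ = ∑ D, ‖c D‖ₑ := Finset.sum_congr rfl fun D _ => by
          rw [hg, eLpNorm_one_indicator_const_div (hEm D) (h_pos _ _ (hE D)).ne',
            ← ofReal_norm, Real.norm_eq_abs]
      _ ≤ ∑ D : (𝒟 n).parts, ∫⁻ ω in (D : Set Ω), ‖f ω‖ₑ ∂P :=
          Finset.sum_le_sum fun D _ => enorm_integral_le_lintegral_enorm _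
      _ = eLpNorm f 1 P := by
          rw [eLpNorm_one_eq_lintegral_enorm, ← tsum_fintype (L := .unconditional _),
            ← lintegral_iUnion hDm hdisj, hU, setLIntegral_univ]
  · symm
    refine ae_eq_condExp_of_forall_setIntegral_eq (ℱ.le n) hGi (fun _ _ _ => hf.integrableOn)
      (fun S hS _ => ?_) hfm.aestronglyMeasurable
    have hSm : MeasurableSet S := ℱ.le n S hS
    have hSU : S = ⋃ D : (𝒟 n).parts, (D : Set Ω) ∩ S := by
      rw [← Set.iUnion_inter, hU, Set.univ_inter]
    have hR : ∫ ω in S, (∑ D, g D) ω ∂P = ∑ D, ∫ ω in S, g D ω ∂P := by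
      simp only [Finset.sum_apply]
      exact integral_finsetSum _ fun D _ => (hgi D).integrableOn
    have hL : ∫ ω in S, f ω ∂P = ∑ D : (𝒟 n).parts, ∫ ω in (D : Set Ω) ∩ S, f ω ∂P := by
      conv_lhs => rw [hSU]
      exact integral_iUnion_fintype (fun D => (hDm D).inter hSm)
        (fun D D' hne => (hdisj hne).mono Set.inter_subset_left Set.inter_subset_left)
        fun D => hf.integrableOn
    rw [hR, hL]
    refine Finset.sum_congr rfl fun D _ => ?_
    -- `S` either contains the cell `D` or misses it, and `E D ⊆ D`.
    rw [hg]
    simp only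
    rw [setIntegral_indicator (hEm D), setIntegral_const, smul_eq_mul]
    have hp : P.real (E D) ≠ 0 :=
      (ENNReal.toReal_pos (h_pos _ _ (hE D)).ne' (measure_ne_top P _)).ne'
    rcases subset_or_disjoint_of_mem_parts h_gen D.2 hS with h | h
    · rw [Set.inter_eq_left.2 h, Set.inter_eq_right.2 ((hED D).trans h), mul_div_cancel₀ _ hp]
    · rw [h.inter_eq, (h.mono_left (hED D)).symm.inter_eq]
      simp
  · have hle : ∀ ω, min |(∑ D, g D) ω| 1 ≤ ∑ D, (E D).indicator (fun _ => (1 : ℝ)) ω := fun ω => by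
      have hnn : ∀ D, 0 ≤ (E D).indicator (fun _ => (1 : ℝ)) ω := fun D =>
        Set.indicator_nonneg (fun _ _ => zero_le_one) ω
      by_cases h : ∃ D, ω ∈ E D
      · obtain ⟨D, hD⟩ := h
        refine (min_le_right _ _).trans ?_
        calc (1 : ℝ) = (E D).indicator (fun _ => (1 : ℝ)) ω := by simp [hD]
          _ ≤ _ := Finset.single_le_sum (f := fun D => (E D).indicator (fun _ => (1 : ℝ)) ω)
            (fun D _ => hnn D) (Finset.mem_univ D)
      · push Not at h
        simp [hg, h]
    calc ∫ ω, min |(∑ D, g D) ω| 1 ∂P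
        ≤ ∫ ω, ∑ D, (E D).indicator (fun _ => (1 : ℝ)) ω ∂P :=
          integral_mono (UnitMartingale.integrable_min_abs_one hGi)
            (integrable_finsetSum _ fun D _ => (integrable_const _).indicator (hEm D)) hle
      _ = ∑ D, P.real (E D) := by
          rw [integral_finsetSum _ fun D _ => (integrable_const _).indicator (hEm D)]
          simp [integral_indicator_const, hEm]
      _ ≤ ∑ _D : (𝒟 n).parts, δ / (r + 1) := Finset.sum_le_sum fun D _ => (hPE D).le
      _ = r * (δ / (r + 1)) := by simp [hr]
      _ < δ := by
          rw [← mul_div_assoc, div_lt_iff₀ (by positivity)]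
          nlinarith

/-- The martingales that are small in measure at some time `k ≥ j`, smallness being measured by the
integral of the truncation `min |f_k| 1`. -/
def smallSet (ℱ : Filtration ℕ m) (P : Measure Ω) (j : ℕ) : Set (UnitMartingale ℱ P) :=
  {f | ∃ k, j ≤ k ∧ ∫ ω, min |f.1 k ω| 1 ∂P < 1 / ((j : ℝ) + 1)}

theorem isOpen_smallSet (j : ℕ) : IsOpen (smallSet ℱ P j) := by
  have h : smallSet ℱ P j = ⋃ k, ⋃ (_ : j ≤ k),
      {f | ∫ ω, min |f.1 k ω| 1 ∂P < 1 / ((j : ℝ) + 1)} := by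
    ext f
    simp [smallSet]
  rw [h]
  exact isOpen_iUnion fun k => isOpen_iUnion fun _ =>
    isOpen_lt (UnitMartingale.continuous_integral_min_abs_one k) continuous_const

theorem dense_smallSet
    (h_gen : ∀ n, ℱ n = MeasurableSpace.generateFrom {D : Set Ω | D ∈ (𝒟 n).parts})
    (h_pos : ∀ n, ∀ D ∈ (𝒟 n).parts, 0 < P D)
    (h_split : ∀ n, ∀ D ∈ (𝒟 n).parts, ∃ k, n < k ∧ D ∉ (𝒟 k).parts) (j : ℕ) :
    Dense (smallSet ℱ P j) := by
  refine UnitMartingale.dense_of_forall_exists_ofFun fun f n ε _ => ?_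
  obtain ⟨k, hjk, G, hGm, hGi, hGn, hcond, hsmall⟩ := exists_condExp_eq_integral_min_lt h_gen h_pos
    h_split (f.2.1.1 n) (f.2.1.integrable n) j (show (0 : ℝ) < 1 / ((j : ℝ) + 1) by positivity)
  refine ⟨G, hGn.trans (f.eLpNorm_le_one n), hGi, ?_, k, hjk, ?_⟩
  · have h0 : P[G | ℱ n] - f.1 n =ᵐ[P] 0 := by
      filter_upwards [hcond] with ω hω
      simp [hω]
    rw [eLpNorm_congr_ae h0]
    simp
  · have : (UnitMartingale.ofFun ℱ G (hGn.trans (f.eLpNorm_le_one n))).1 k = G :=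
      condExp_of_stronglyMeasurable (ℱ.le k) hGm hGi
    rwa [this]

/-- An `L¹`-bounded martingale has an almost sure limit, and this limit vanishes if the martingale
is arbitrarily small in measure at arbitrarily late times. -/
theorem ae_tendsto_zero_of_forall_mem_smallSet {f : UnitMartingale ℱ P}
    (hf : ∀ j, f ∈ smallSet ℱ P j) : ∀ᵐ ω ∂P, Tendsto (fun n => f.1 n ω) atTop (𝓝 0) := by
  obtain ⟨F, hF, hlim⟩ := exists_stronglyMeasurable_limit_of_tendsto_ae
    (fun n => (f.2.1.integrable n).aestronglyMeasurable)
    (f.2.1.submartingale.exists_ae_tendsto_of_bdd (R := 1) fun n => f.eLpNorm_le_one n)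
  have hint : ∀ n, Integrable (fun ω => min |f.1 n ω| 1) P := fun n =>
    UnitMartingale.integrable_min_abs_one (f.2.1.integrable n)
  have hbound : ∀ t : ℝ, ‖min |t| 1‖ ≤ 1 := fun t => by
    rw [Real.norm_eq_abs, abs_of_nonneg (le_min (abs_nonneg t) zero_le_one)]
    exact min_le_right _ _
  have hconv : Tendsto (fun n => ∫ ω, min |f.1 n ω| 1 ∂P) atTop (𝓝 (∫ ω, min |F ω| 1 ∂P)) := by
    refine tendsto_integral_of_dominated_convergence (fun _ => 1)
      (fun n => (hint n).aestronglyMeasurable) (integrable_const 1)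
      (fun n => Eventually.of_forall fun ω => hbound _) ?_
    filter_upwards [hlim] with ω hω
    exact hω.abs.min tendsto_const_nhds
  choose k hk hsmall using hf
  have hktop : Tendsto k atTop atTop := tendsto_atTop_mono hk tendsto_id
  have hnn : ∀ g : Ω → ℝ, 0 ≤ fun ω => min |g ω| 1 := fun g ω =>
    le_min (abs_nonneg _) zero_le_one
  have hzero : ∫ ω, min |F ω| 1 ∂P = 0 :=
    le_antisymm (le_of_tendsto_of_tendsto' (hconv.comp hktop)
      tendsto_one_div_add_atTop_nhds_zero_nat fun j => (hsmall j).le)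
      (integral_nonneg (hnn F))
  have hFi : Integrable (fun ω => min |F ω| 1) P :=
    (integrable_const (1 : ℝ)).mono' (hF.aestronglyMeasurable.norm.inf aestronglyMeasurable_const)
      (Eventually.of_forall fun ω => hbound _)
  have hF0 := (integral_eq_zero_iff_of_nonneg (hnn F) hFi).1 hzero
  filter_upwards [hlim, hF0] with ω hω h0
  have : F ω = 0 := by
    rcases min_choice |F ω| 1 with h | h
    · exact abs_eq_zero.1 (h.symm.trans h0)
    · exact absurd (h.symm.trans h0) one_ne_zero
  rwa [this] at hω

/-- If `f` is in all the sets `exceedSet` with sign `s`, then the points of the limit space at which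
`s * f_n` exceeds `N` at some time after `N` are dense. -/
theorem dense_setOf_lt_valueAt
    (h_gen : ∀ n, ℱ n = MeasurableSpace.generateFrom {D : Set Ω | D ∈ (𝒟 n).parts})
    (h_pos : ∀ n, ∀ D ∈ (𝒟 n).parts, 0 < P D) {s : ℝ} {N : ℕ} {f : UnitMartingale ℱ P}
    (hf : ∀ l, ∀ D ∈ (𝒟 l).parts, f ∈ exceedSet ℱ P 𝒟 s N D) :
    Dense {x : LimitSpace 𝒟 | ∃ n, N ≤ n ∧ (N : ℝ) < s * valueAt f.1 n x} := by
  rw [dense_iff_inter_open]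
  rintro U hU ⟨x, hx⟩
  obtain ⟨l, hl⟩ := LimitSpace.exists_cell_subset hU hx
  obtain ⟨k, hNk, E, hE, hED, hlt⟩ := hf l (x.cell l) (x.1 l).2
  obtain ⟨y, rfl⟩ := LimitSpace.exists_cell_eq h_gen hE
  refine ⟨y, hl y ?_, k, hNk, ?_⟩
  -- The time `k` may come before `l`; then `y.cell l` is a part of `y.cell k ⊆ x.cell l`.
  · rcases le_total l k with hlk | hkl
    · obtain ⟨ω, hω⟩ := y.cell_nonempty k
      exact (Finpartition.eq_of_mem_of_mem (y.1 l).2 (x.1 l).2 (y.2 l k hlk hω) (hED hω)).le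
    · exact (y.2 k l hkl).trans hED
  · have hm : MeasurableSet (y.cell k) := ℱ.le k _ (measurableSet_of_mem_parts h_gen hE)
    have hval : ∀ ω ∈ y.cell k, f.1 k ω = valueAt f.1 k y := fun ω hω =>
      eq_of_mem_of_mem_of_stronglyMeasurable h_gen hE (f.2.1.1 k) hω (y.cell_nonempty k).some_mem
    have hp : 0 < P.real (y.cell k) :=
      ENNReal.toReal_pos (h_pos k _ hE).ne' (measure_ne_top P _)
    rw [setIntegral_congr_fun hm hval, setIntegral_const, smul_eq_mul] at hlt
    exact lt_of_mul_lt_mul_right (hlt.trans_eq (by ring)) hp.le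

theorem isOpen_setOf_exists_lt_valueAt (f : ℕ → Ω → ℝ) (s : ℝ) (N : ℕ) :
    IsOpen {x : LimitSpace 𝒟 | ∃ n, N ≤ n ∧ (N : ℝ) < s * valueAt f n x} := by
  have h : {x : LimitSpace 𝒟 | ∃ n, N ≤ n ∧ (N : ℝ) < s * valueAt f n x} =
      ⋃ n, ⋃ (_ : N ≤ n), {x | (N : ℝ) < s * valueAt f n x} := by
    ext x
    simp
  rw [h]
  exact isOpen_iUnion fun n => isOpen_iUnion fun _ => isOpen_setOf_valueAt f n fun t => N < s * t

end Generic

/-! ### The comeager set of martingales -/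

theorem theorem4p3 {Ω : Type*} [m : MeasurableSpace Ω] (P : Measure Ω) [IsProbabilityMeasure P]
    (ℱ : Filtration ℕ m) (𝒟 : ℕ → Finpartition (Set.univ : Set Ω))
    (h_gen : ∀ n, ℱ n = MeasurableSpace.generateFrom {D : Set Ω | D ∈ (𝒟 n).parts})
    (h_pos : ∀ n, ∀ D ∈ (𝒟 n).parts, 0 < P D)
    (h_split : ∀ n, ∀ D ∈ (𝒟 n).parts, ∃ k, n < k ∧ D ∉ (𝒟 k).parts) :
    ∃ A : Set (UnitMartingale ℱ P), A ∈ residual (UnitMartingale ℱ P) ∧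
      ∀ f ∈ A,
        (∀ᵐ ω ∂P, Tendsto (fun n => f.1 n ω) atTop (𝓝 0)) ∧
        IsGδ (oscillationSet 𝒟 f.1) ∧ Dense (oscillationSet 𝒟 f.1) := by
  have hexceed : ∀ s : ℝ, |s| = 1 →
      (⋂ N : ℕ, ⋂ l : ℕ, ⋂ D : (𝒟 l).parts, exceedSet ℱ P 𝒟 s N D) ∈
        residual (UnitMartingale ℱ P) := fun s hs =>
    countable_iInter_mem.2 fun N => countable_iInter_mem.2 fun l => countable_iInter_mem.2 fun D =>
      residual_of_dense_open (isOpen_exceedSet (𝒟 := 𝒟) s N D.1)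
        (dense_exceedSet h_gen h_pos h_split hs N D.2)
  refine ⟨(⋂ j, smallSet ℱ P j) ∩
      ((⋂ N : ℕ, ⋂ l : ℕ, ⋂ D : (𝒟 l).parts, exceedSet ℱ P 𝒟 1 N D) ∩
        ⋂ N : ℕ, ⋂ l : ℕ, ⋂ D : (𝒟 l).parts, exceedSet ℱ P 𝒟 (-1) N D),
    inter_mem (countable_iInter_mem.2 fun j => residual_of_dense_open (isOpen_smallSet j)
      (dense_smallSet h_gen h_pos h_split j))
      (inter_mem (hexceed 1 (by simp)) (hexceed (-1) (by simp))), ?_⟩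
  rintro f ⟨hsmall, hpos, hneg⟩
  refine ⟨ae_tendsto_zero_of_forall_mem_smallSet (Set.mem_iInter.1 hsmall), ?_⟩
  have hdense : ∀ s : ℝ,
      f ∈ (⋂ N : ℕ, ⋂ l : ℕ, ⋂ D : (𝒟 l).parts, exceedSet ℱ P 𝒟 s N D) → ∀ N : ℕ,
      Dense {x : LimitSpace 𝒟 | ∃ n, N ≤ n ∧ (N : ℝ) < s * valueAt f.1 n x} := fun s hs N => by
    simp only [Set.mem_iInter] at hs
    exact dense_setOf_lt_valueAt h_gen h_pos fun l D hD => hs N l ⟨D, hD⟩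
  have hGδ : ∀ s : ℝ,
      IsGδ (⋂ N : ℕ, {x : LimitSpace 𝒟 | ∃ n, N ≤ n ∧ (N : ℝ) < s * valueAt f.1 n x}) := fun s =>
    .iInter_of_isOpen fun N => isOpen_setOf_exists_lt_valueAt f.1 s N
  have heq : oscillationSet 𝒟 f.1 =
      (⋂ N : ℕ, {x | ∃ n, N ≤ n ∧ (N : ℝ) < 1 * valueAt f.1 n x}) ∩
        ⋂ N : ℕ, {x | ∃ n, N ≤ n ∧ (N : ℝ) < -1 * valueAt f.1 n x} := by
    simpa only [one_mul, neg_one_mul] using oscillationSet_eq_iInter (𝒟 := 𝒟) f.1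
  have := LimitSpace.baireSpace 𝒟
  have hd : ∀ s : ℝ,
      f ∈ (⋂ N : ℕ, ⋂ l : ℕ, ⋂ D : (𝒟 l).parts, exceedSet ℱ P 𝒟 s N D) →
      Dense (⋂ N : ℕ, {x : LimitSpace 𝒟 | ∃ n, N ≤ n ∧ (N : ℝ) < s * valueAt f.1 n x}) :=
    fun s hs => dense_iInter_of_isOpen (fun N => isOpen_setOf_exists_lt_valueAt f.1 s N)
      (hdense s hs)
  rw [heq]
  exact ⟨(hGδ 1).inter (hGδ (-1)), (hd 1 hpos).inter_of_Gδ (hGδ 1) (hGδ (-1)) (hd (-1) hneg)⟩
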